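/- Let $n \ge 3$ be an integer and let $(V,Q)$ be an $n$-dimensional quadratic space over the field $\mathbb{F}_3$ with associated bilinear form $(x,y)=Q(x+y)-Q(x)-Q(y)$ (so $Q(x)=2(x,x)=-(x,x)$), such that the Gram matrix of $(\cdot,\cdot)$ with respect to some basis of $V$ has determinant $1$. For $v\in V$ with $Q(v)\neq 0$ let $t(v)\colon w\mapsto w-\frac{(v,w)}{Q(v)}\,v$ be the reflection in $v$. Let $O_n^{+,+}(3)$ be the group generated by the reflections $t(v)$ with $Q(v)=1$, and let $PO_n^{+,+}(3)$ be its quotient by the subgroup of scalar transformations that it contains. Let $G\cong PO_n^{+,+}(3)$, and let $D\subseteq G$ correspond under this isomorphism to the set of images of the reflections $t(v)$ with $Q(v)=1$. Let $\varphi(G)$ be the largest $m$ for which there is an injective homomorphism $S_m\to G$ that maps every transposition of $S_m$ into $D$. Then this maximum exists, and $$\varphi(G)=\begin{cases} n, & n\equiv 1 \pmod 3,\\ n+1, & \text{otherwise.}\end{cases}$$ -/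

import Mathlib

/-! Orthogonal reflection groups over a field, their projective versions, and the symmetric
groups they contain. The bilinear form of a quadratic space `(V, Q)` is the polar form
`(x, y) = Q (x + y) - Q x - Q y`, so that `(x, x) = 2 Q x`. -/

section QuadraticSpaces

variable {K V : Type*} [Field K] [AddCommGroup V] [Module K V]

/-- The isometry group of the quadratic space `(V, Q)`. -/
def isometrySubgroup (Q : QuadraticForm K V) : Subgroup (V ≃ₗ[K] V) where
  carrier := {g | ∀ x, Q (g x) = Q x}
  one_mem' := fun _ => rfl
  mul_mem' := fun {g h} hg hh x => by
    rw [LinearEquiv.mul_apply, hg, hh]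
  inv_mem' := fun {g} hg x => by
    have h := hg (g⁻¹ x)
    rw [← LinearEquiv.mul_apply, mul_inv_cancel] at h
    exact h.symm

theorem coform_apply_self (Q : QuadraticForm K V) {v : V} (hv : Q v ≠ 0) :
    ((Q v)⁻¹ • QuadraticMap.polarBilin Q v) v = 2 := by
  rw [LinearMap.smul_apply, QuadraticMap.polarBilin_apply_apply, QuadraticMap.polar_self,
    nsmul_eq_mul, smul_eq_mul, mul_comm, mul_assoc, mul_inv_cancel₀ hv]
  norm_num

/-- The reflection `t(v) : w ↦ w - ((v, w) / Q v) v` in a vector `v` with `Q v ≠ 0`. -/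
noncomputable def quadReflection (Q : QuadraticForm K V) (v : V) (hv : Q v ≠ 0) : V ≃ₗ[K] V :=
  Module.reflection (coform_apply_self Q hv)

theorem quadReflection_apply (Q : QuadraticForm K V) (v : V) (hv : Q v ≠ 0) (w : V) :
    quadReflection Q v hv w = w - ((Q v)⁻¹ * QuadraticMap.polar Q v w) • v := by
  rw [quadReflection, Module.reflection_apply, LinearMap.smul_apply,
    QuadraticMap.polarBilin_apply_apply, smul_eq_mul]

/-- The set of the reflections `t(v)` with `Q v = π`. -/
def reflectionClass (Q : QuadraticForm K V) (π : K) : Set (V ≃ₗ[K] V) :=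
  {g | ∃ (v : V) (hv : Q v ≠ 0), Q v = π ∧ g = quadReflection Q v hv}

/-- The group generated by the reflections `t(v)` with `Q v = π`. -/
def reflectionSubgroup (Q : QuadraticForm K V) (π : K) : Subgroup (V ≃ₗ[K] V) :=
  Subgroup.closure (reflectionClass Q π)

theorem reflectionSubgroup_le_isometrySubgroup (Q : QuadraticForm K V) (π : K) :
    reflectionSubgroup Q π ≤ isometrySubgroup Q := by
  refine (Subgroup.closure_le _).2 ?_
  rintro g ⟨v, hv, -, rfl⟩ w
  have h : ∀ a : K, Q (w - a • v) = Q w + a * a * Q v - a * QuadraticMap.polar Q v w := by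
    intro a
    rw [sub_eq_add_neg, ← neg_smul, QuadraticMap.map_add Q, QuadraticMap.map_smul,
      QuadraticMap.polar_smul_right, QuadraticMap.polar_comm Q w v]
    simp only [smul_eq_mul]
    ring
  rw [quadReflection_apply, h]
  field_simp
  ring

variable (K V) in
/-- The group of the invertible scalar transformations `v ↦ c v` of `V`. -/
def scalarSubgroup : Subgroup (V ≃ₗ[K] V) :=
  (DistribMulAction.toModuleAut K V : Kˣ →* (V ≃ₗ[K] V)).range

instance scalarSubgroup_normal : (scalarSubgroup K V).Normal where
  conj_mem := by
    rintro _ ⟨c, rfl⟩ g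
    refine ⟨c, LinearEquiv.ext fun v => ?_⟩
    have h : g (g⁻¹ v) = v := by
      rw [← LinearEquiv.mul_apply, mul_inv_cancel]
      rfl
    change (c : K) • v = g ((c : K) • g⁻¹ v)
    rw [map_smul, h]

/-- The projective group: the reflection group of `Q` and `π` modulo the scalar
transformations that it contains. -/
abbrev ProjReflectionGroup (Q : QuadraticForm K V) (π : K) : Type _ :=
  (reflectionSubgroup Q π) ⧸ (scalarSubgroup K V).subgroupOf (reflectionSubgroup Q π)

/-- The image in the projective group of the set of the reflections `t(v)` with `Q v = π`. -/
def projReflectionClass (Q : QuadraticForm K V) (π : K) : Set (ProjReflectionGroup Q π) :=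
  {x | ∃ g : reflectionSubgroup Q π, (g : V ≃ₗ[K] V) ∈ reflectionClass Q π ∧
    x = QuotientGroup.mk g}

/-- `V` has dimension `n`, and the Gram matrix of the bilinear form of `Q` with respect to some
basis of `V` has determinant `μ`. -/
def HasGramDet (Q : QuadraticForm K V) (n : ℕ) (μ : K) : Prop :=
  ∃ b : Module.Basis (Fin n) K V,
    (Matrix.of fun i j => QuadraticMap.polar Q (b i) (b j)).det = μ

end QuadraticSpaces

/-- The natural numbers `m` for which there is a monomorphism from the symmetric group `S_m` to
`G` that maps every transposition into `D`. -/
def symmetricDegrees {G : Type*} [Group G] (D : Set G) : Set ℕ :=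
  {m | ∃ f : Equiv.Perm (Fin m) →* G, Function.Injective f ∧
    ∀ i j : Fin m, i ≠ j → f (Equiv.swap i j) ∈ D}

/-!
Over `𝔽₃`, the reflections `t(v)` with `Q v = 1` are those in vectors of norm `(v, v) = 2`, like the
roots of a root lattice of type `A`. The group `S_m` acts on the root lattice `A_{m-1}` with its
transpositions acting as the reflections in roots, and `A_{m-1}` has determinant `m`. Reducing
modulo `3`, the question is how large a lattice `A_{m-1}` fits into `V`.

Lower bound. A space with Gram determinant `1` has an orthonormal basis
(`exists_orthonormal_of_hasGramDet_one`). Points `u i` of `V` whose differences have the inner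
products of the roots of type `A` carry an action of the symmetric group by the explicit formula
`v ↦ v + ∑ k, (u k, v) • (u (σ k) - u k)`, which makes sense even when the form on the span of the
differences is degenerate; the transposition of `i` and `j` acts as `t(u i - u j)`
(`IsSimplexConfiguration.permRep`). For at least four points only the identity acts as a scalar
(`IsSimplexConfiguration.eq_one_of_permRep_mem_scalarSubgroup`). An orthonormal basis gives `n`
such points, and for `n ≢ 1` modulo `3` one finds `n + 1` of them.

Upper bound. Given an embedding of `S_{k+1}`, the transpositions `(0 i)` are reflections in `k`
vectors whose Gram matrix is, after changes of sign, the identity plus the all-ones matrix, of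
determinant `k + 1` (`exists_star_family`). Passing to the projective group loses nothing here, as
two reflections in dimension at least three fix a common nonzero vector
(`polar_eq_zero_of_commute`). If `n ≢ 1`, then `k = n + 1` is impossible: the determinant `n + 2` is
nonzero, so the vectors would be independent. If `n ≡ 1`, then `k = n` is impossible: the
determinant `n + 1 = 2` is not a square, whereas Gram determinants of `n` vectors are squares times
the discriminant `1` (`gram_det_eq_sq_mul`).
-/

/-! ### Permutation representations from simplex configurations -/

section SimplexConfiguration

variable {K V ι : Type*} [Field K] [AddCommGroup V] [Module K V]

/-- The family `u` is a simplex configuration with offsets `a`: up to the additive terms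
`a i + a j`, its Gram matrix for the polar form of `Q` is the identity. The offsets do not affect
the differences `u i - u j`, which therefore have the inner products of the roots of type `A`. -/
def IsSimplexConfiguration [DecidableEq ι] (Q : QuadraticForm K V) (u : ι → V) (a : ι → K) : Prop :=
  ∀ i j, QuadraticMap.polarBilin Q (u i) (u j) = (if i = j then 1 else 0) + a i + a j

/-- For a simplex configuration `u`, the endomorphism of `V` that sends each difference
`u i - u j` to `u (σ i) - u (σ j)` and fixes the vectors orthogonal to all these differences. -/
def simplexEnd [Fintype ι] (Q : QuadraticForm K V) (u : ι → V) (σ : Equiv.Perm ι) : V →ₗ[K] V :=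
  LinearMap.id + ∑ k, (QuadraticMap.polarBilin Q (u k)).smulRight (u (σ k) - u k)

theorem simplexEnd_apply [Fintype ι] (Q : QuadraticForm K V) (u : ι → V) (σ : Equiv.Perm ι)
    (v : V) :
    simplexEnd Q u σ v = v + ∑ k, QuadraticMap.polarBilin Q (u k) v • (u (σ k) - u k) := by
  simp [simplexEnd]

theorem simplexEnd_one [Fintype ι] (Q : QuadraticForm K V) (u : ι → V) (v : V) :
    simplexEnd Q u (1 : Equiv.Perm ι) v = v := by
  simp [simplexEnd_apply]

theorem sum_apply_perm_sub_eq_zero [Fintype ι] (u : ι → V) (σ : Equiv.Perm ι) :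
    ∑ k, (u (σ k) - u k) = 0 := by
  rw [Finset.sum_sub_distrib, Equiv.sum_comp σ u, sub_self]

namespace IsSimplexConfiguration

variable [DecidableEq ι] {Q : QuadraticForm K V} {u : ι → V} {a : ι → K}

theorem map_sub_eq_one (h : IsSimplexConfiguration Q u a) (h2 : (2 : K) ≠ 0) {i j : ι}
    (hij : i ≠ j) : Q (u i - u j) = 1 := by
  have h1 : QuadraticMap.polarBilin Q (u i - u j) (u i - u j) = 2 := by
    simp only [map_sub, LinearMap.sub_apply, h _ _, hij, hij.symm, if_true, if_false]
    ring
  rw [QuadraticMap.polarBilin_apply_apply, QuadraticMap.polar_self, nsmul_eq_mul] at h1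
  exact mul_left_cancel₀ h2 (by simpa using h1)

variable [Fintype ι]

/-- The inner products of a transformed vector with the configuration are the permuted ones, up to
a constant, which is harmless because the vectors `u (σ k) - u k` sum to zero. -/
theorem polarBilin_simplexEnd (h : IsSimplexConfiguration Q u a) (τ : Equiv.Perm ι) (v : V) :
    ∃ c : K, ∀ k, QuadraticMap.polarBilin Q (u k) (simplexEnd Q u τ v) =
      QuadraticMap.polarBilin Q (u (τ⁻¹ k)) v + c := by
  refine ⟨∑ l, QuadraticMap.polarBilin Q (u l) v * (a (τ l) - a l), fun k => ?_⟩
  have hl : ∀ l, QuadraticMap.polarBilin Q (u k) (u (τ l) - u l) =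
      (if l = τ⁻¹ k then 1 else 0) - (if l = k then 1 else 0) + (a (τ l) - a l) := by
    intro l
    have h1 : (k = τ l) = (l = τ⁻¹ k) := by
      rw [Equiv.Perm.eq_inv_iff_eq, eq_comm (a := k)]
    rw [map_sub, h, h]
    simp only [h1, eq_comm (a := k)]
    ring
  rw [simplexEnd_apply, map_add, map_sum]
  simp only [map_smul, smul_eq_mul, hl, mul_add, mul_sub, Finset.sum_add_distrib,
    Finset.sum_sub_distrib, mul_ite, mul_one, mul_zero, Finset.sum_ite_eq', Finset.mem_univ,
    if_true]
  ring

theorem simplexEnd_mul (h : IsSimplexConfiguration Q u a) (σ τ : Equiv.Perm ι) (v : V) :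
    simplexEnd Q u (σ * τ) v = simplexEnd Q u σ (simplexEnd Q u τ v) := by
  obtain ⟨c, hc⟩ := h.polarBilin_simplexEnd τ v
  rw [simplexEnd_apply Q u σ]
  simp only [hc, add_smul, Finset.sum_add_distrib, ← Finset.smul_sum,
    sum_apply_perm_sub_eq_zero, smul_zero, add_zero]
  rw [← Equiv.sum_comp τ, simplexEnd_apply, simplexEnd_apply, add_assoc,
    ← Finset.sum_add_distrib]
  congr 1
  refine Finset.sum_congr rfl fun k _ => ?_
  rw [show τ⁻¹ (τ k) = k from τ.symm_apply_apply k, ← smul_add, Equiv.Perm.mul_apply]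
  congr 1
  abel

/-- The representation of the symmetric group on `V` attached to a simplex configuration. -/
def permRep (h : IsSimplexConfiguration Q u a) : Equiv.Perm ι →* (V ≃ₗ[K] V) where
  toFun σ := LinearEquiv.ofLinearMap (simplexEnd Q u σ) (simplexEnd Q u σ⁻¹)
    (LinearMap.ext fun v => by
      rw [LinearMap.comp_apply, ← h.simplexEnd_mul, mul_inv_cancel, simplexEnd_one,
        LinearMap.id_apply])
    (LinearMap.ext fun v => by
      rw [LinearMap.comp_apply, ← h.simplexEnd_mul, inv_mul_cancel, simplexEnd_one,
        LinearMap.id_apply])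
  map_one' := LinearEquiv.ext fun v => simplexEnd_one Q u v
  map_mul' σ τ := LinearEquiv.ext fun v => h.simplexEnd_mul σ τ v

theorem permRep_apply (h : IsSimplexConfiguration Q u a) (σ : Equiv.Perm ι) (v : V) :
    h.permRep σ v = v + ∑ k, QuadraticMap.polarBilin Q (u k) v • (u (σ k) - u k) :=
  simplexEnd_apply Q u σ v

theorem permRep_sub (h : IsSimplexConfiguration Q u a) (σ : Equiv.Perm ι) (i j : ι) :
    h.permRep σ (u i - u j) = u (σ i) - u (σ j) := by
  have hs : ∀ k, QuadraticMap.polarBilin Q (u k) (u i - u j) • (u (σ k) - u k) =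
      (if k = i then u (σ k) - u k else 0) - (if k = j then u (σ k) - u k else 0) +
        (a i - a j) • (u (σ k) - u k) := by
    intro k
    rw [map_sub, h, h]
    have : ∀ x y : K, x + a k + a i - (y + a k + a j) = x - y + (a i - a j) := by
      intros; ring
    rw [this, add_smul, sub_smul, ite_smul, ite_smul, one_smul, zero_smul]
  rw [permRep_apply, Finset.sum_congr rfl fun k _ => hs k, Finset.sum_add_distrib,
    Finset.sum_sub_distrib, ← Finset.smul_sum, sum_apply_perm_sub_eq_zero]
  simp only [Finset.sum_ite_eq', Finset.mem_univ, if_true, smul_zero]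
  abel

theorem permRep_swap_mem (h : IsSimplexConfiguration Q u a) (h2 : (2 : K) ≠ 0) {i j : ι}
    (hij : i ≠ j) : h.permRep (Equiv.swap i j) ∈ reflectionClass Q 1 := by
  have h1 := h.map_sub_eq_one h2 hij
  refine ⟨u i - u j, by simp [h1], h1, LinearEquiv.ext fun v => ?_⟩
  rw [quadReflection_apply, permRep_apply, h1, inv_one, one_mul,
    ← QuadraticMap.polarBilin_apply_apply, map_sub, LinearMap.sub_apply,
    Fintype.sum_eq_add i j hij]
  · simp only [Equiv.swap_apply_left, Equiv.swap_apply_right]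
    module
  · rintro k ⟨hi, hj⟩
    rw [Equiv.swap_apply_of_ne_of_ne hi hj, sub_self, smul_zero]

theorem permRep_mem (h : IsSimplexConfiguration Q u a) (h2 : (2 : K) ≠ 0) (σ : Equiv.Perm ι) :
    h.permRep σ ∈ reflectionSubgroup Q 1 := by
  induction σ using Equiv.Perm.swap_induction_on with
  | one => rw [map_one]; exact one_mem _
  | swap_mul f i j hij hf =>
    rw [map_mul]
    exact mul_mem (Subgroup.subset_closure (h.permRep_swap_mem h2 hij)) hf

/-- For at least four points the representation stays faithful modulo scalars: if `σ` acts as the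
scalar `c` and moves `i`, then comparing inner products of the equal vectors
`u (σ i) - u (σ j)` and `c • (u i - u j)`, for a suitable `j`, with differences `u k - u l` gives a
contradiction. -/
theorem eq_one_of_permRep_mem_scalarSubgroup (h : IsSimplexConfiguration Q u a)
    (h2 : (2 : K) ≠ 0) (hι : 4 ≤ Fintype.card ι) (σ : Equiv.Perm ι)
    (hσ : h.permRep σ ∈ scalarSubgroup K V) : σ = 1 := by
  obtain ⟨c, hc⟩ := hσ
  have key : ∀ i j k l : ι,
      ((if k = σ i then 1 else 0) - (if k = σ j then 1 else 0)
        - (c : K) * ((if k = i then 1 else 0) - (if k = j then 1 else 0))) =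
      ((if l = σ i then 1 else 0) - (if l = σ j then 1 else 0)
        - (c : K) * ((if l = i then 1 else 0) - (if l = j then 1 else 0))) := by
    intro i j k l
    have h1 : u (σ i) - u (σ j) = (c : K) • (u i - u j) := by
      rw [← h.permRep_sub, ← hc]
      rfl
    have h3 := congrArg (QuadraticMap.polarBilin Q (u k - u l)) h1
    simp only [map_sub, map_smul, LinearMap.sub_apply, h _ _, smul_eq_mul] at h3
    linear_combination h3
  by_contra hne
  obtain ⟨i, hi⟩ : ∃ i, σ i ≠ i := by
    by_contra! hall
    exact hne (Equiv.ext hall)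
  have avoid : ∀ x y z : ι, ∃ w, w ≠ x ∧ w ≠ y ∧ w ≠ z := by
    intro x y z
    have : ({x, y, z} : Finset ι).card < Fintype.card ι :=
      lt_of_le_of_lt Finset.card_le_three (by omega)
    obtain ⟨w, hw⟩ := Finset.exists_mem_notMem_of_card_lt_card
      (s := {x, y, z}) (t := Finset.univ) (by simpa using this)
    exact ⟨w, by simpa using hw.2⟩
  obtain ⟨j, hji, hjp, hjq⟩ := avoid i (σ i) (σ⁻¹ i)
  have hσji : σ j ≠ i := fun hh => hjq (Equiv.Perm.eq_inv_iff_eq.2 hh)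
  have hσij : σ i ≠ σ j := fun hh => hji (σ.injective hh).symm
  by_cases hj : σ j = j
  · obtain ⟨k, hki, hkp, hkj⟩ := avoid i (σ i) j
    have k2 := key i j (σ i) k
    simp [hi, hjp.symm, hj, hki, hkp, hkj] at k2
  · have k2 := key i j (σ i) (σ j)
    simp only [hi, hσij, hσij.symm, hσji, hjp.symm, hj, if_true, if_false] at k2
    exact h2 (by linear_combination k2)

/-- A simplex configuration of `m ≥ 4` points embeds the symmetric group of degree `m`. -/
theorem mem_symmetricDegrees {m : ℕ} {u : Fin m → V} {a : Fin m → K}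
    (h : IsSimplexConfiguration Q u a) (h2 : (2 : K) ≠ 0) (hm : 4 ≤ m) :
    m ∈ symmetricDegrees (projReflectionClass Q (1 : K)) := by
  refine ⟨(QuotientGroup.mk' _).comp (h.permRep.codRestrict _ (h.permRep_mem h2)), ?_, ?_⟩
  · refine (injective_iff_map_eq_one _).2 fun σ hσ => ?_
    refine h.eq_one_of_permRep_mem_scalarSubgroup h2 (by simpa using hm) σ ?_
    rw [MonoidHom.comp_apply, QuotientGroup.mk'_apply, QuotientGroup.eq_one_iff] at hσ
    exact hσ
  · intro i j hij
    exact ⟨_, h.permRep_swap_mem h2 hij, rfl⟩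

end IsSimplexConfiguration

end SimplexConfiguration

/-! ### Gram determinants and orthonormal bases over the field with three elements -/

section GramDeterminant

variable {K V : Type*} [Field K] [AddCommGroup V] [Module K V]

theorem gram_det_eq_sq_mul {n : ℕ} (Q : QuadraticForm K V) (b : Module.Basis (Fin n) K V)
    (w : Fin n → V) :
    (Matrix.of fun i j => QuadraticMap.polar Q (w i) (w j)).det =
      b.det w ^ 2 * (Matrix.of fun i j => QuadraticMap.polar Q (b i) (b j)).det := by
  have h : (Matrix.of fun i j => QuadraticMap.polar Q (w i) (w j)) =
      (b.toMatrix w).transpose * (Matrix.of fun i j => QuadraticMap.polar Q (b i) (b j)) *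
        b.toMatrix w := by
    ext i j
    simp only [Matrix.of_apply, Matrix.mul_apply, Matrix.transpose_apply,
      Module.Basis.toMatrix_apply, ← QuadraticMap.polarBilin_apply_apply]
    conv_lhs => rw [← b.sum_repr (w i), ← b.sum_repr (w j)]
    simp only [map_sum, map_smul, LinearMap.sum_apply, LinearMap.smul_apply, smul_eq_mul,
      Finset.sum_mul, Finset.mul_sum]
    refine Finset.sum_congr rfl fun k _ => Finset.sum_congr rfl fun l _ => ?_
    ring
  rw [h, Matrix.det_mul, Matrix.det_mul, Matrix.det_transpose, Module.Basis.det_apply]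
  ring

/-- A family of vectors with nonzero Gram determinant is linearly independent, so it has at most
as many members as the dimension of the space. -/
theorem le_of_gram_det_ne_zero {k n : ℕ} (Q : QuadraticForm K V) (b : Module.Basis (Fin n) K V)
    (w : Fin k → V)
    (hw : (Matrix.of fun i j => QuadraticMap.polar Q (w i) (w j)).det ≠ 0) : k ≤ n := by
  have : Module.Finite K V := Module.Finite.of_basis b
  have hli : LinearIndependent K w := by
    rw [Fintype.linearIndependent_iff]
    intro g hg
    by_contra! hne
    refine hw (Matrix.exists_mulVec_eq_zero_iff.1 ⟨g, fun h0 => ?_, funext fun i => ?_⟩)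
    · obtain ⟨i, hi⟩ := hne
      exact hi (congrFun h0 i)
    · have h1 := congrArg (QuadraticMap.polarBilin Q (w i)) hg
      simpa [Matrix.mulVec, dotProduct, mul_comm] using h1
  simpa [Module.finrank_eq_card_basis b] using hli.fintype_card_le_finrank

/-- The Gram matrix of `k` vectors with `Q = 1` and pairwise inner product `1` is the sum of the
identity and the all-ones matrix. -/
theorem det_one_add_all_ones (k : ℕ) :
    (Matrix.of fun i j : Fin k => (if i = j then 2 else 1 : K)).det = k + 1 := by
  have h : (Matrix.of fun i j : Fin k => (if i = j then 2 else 1 : K)) =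
      1 + Matrix.replicateCol Unit (fun _ => (1 : K)) *
        Matrix.replicateRow Unit (fun _ => (1 : K)) := by
    ext i j
    by_cases hij : i = j
    · simp [hij, Matrix.mul_apply]
      norm_num
    · simp [hij, Matrix.mul_apply]
  rw [h, Matrix.det_one_add_replicateCol_mul_replicateRow]
  simp [dotProduct, add_comm]

end GramDeterminant

section Orthonormal

variable {V : Type*} [AddCommGroup V] [Module (ZMod 3) V]

/-- An orthogonal family of vectors with norms `1` and `-1`, where `-1` occurs an even number of
times, can be made orthonormal: two orthogonal vectors `x`, `y` of norm `-1` are replaced by `x + y`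
and `x - y`, of norm `-2 = 1`. -/
theorem exists_orthonormal_of_even {ι : Type*} [Fintype ι] [DecidableEq ι]
    (B : LinearMap.BilinForm (ZMod 3) V) (N : Finset ι) (hN : Even N.card) (w : ι → V)
    (hw : ∀ i j, B (w i) (w j) =
      if i = j then (if i ∈ N then -1 else 1) else 0) :
    ∃ e : ι → V, ∀ i j, B (e i) (e j) = if i = j then 1 else 0 := by
  induction hc : N.card using Nat.strong_induction_on generalizing N w with
  | _ c ih =>
    obtain rfl | ⟨x, hx⟩ := N.eq_empty_or_nonempty
    · exact ⟨w, by simpa using hw⟩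
    · have hpos : 0 < N.card := Finset.card_pos.2 ⟨x, hx⟩
      have hgt : 1 < N.card := by
        obtain ⟨r, hr⟩ := hN
        omega
      obtain ⟨y, hy, hyx⟩ := Finset.exists_mem_ne hgt x
      have hcard : ((N.erase x).erase y).card = N.card - 2 := by
        rw [Finset.card_erase_of_mem (Finset.mem_erase.2 ⟨hyx, hy⟩), Finset.card_erase_of_mem hx]
        omega
      refine ih (N.card - 2) (by omega) ((N.erase x).erase y)
        (by rw [hcard]; exact (Nat.even_sub hgt).2 (by simp [hN]))
        (fun i => if i = x then w x + w y else if i = y then w x - w y else w i)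
        (fun i j => ?_) hcard
      have h2 : (-1 + -1 : ZMod 3) = 1 := by decide
      have h3 : ((-1 : ZMod 3) - 1) = 1 := by decide
      have e1 : ∀ k, k ≠ x → (x = k) = False := fun k hk => eq_false hk.symm
      have e2 : ∀ k, k ≠ y → (y = k) = False := fun k hk => eq_false hk.symm
      by_cases hix : i = x
      · by_cases hjx : j = x
        · simp [hix, hjx, hw, hx, hy, hyx, hyx.symm, h2]
        · by_cases hjy : j = y
          · simp [hix, hjy, hw, hx, hy, hyx, hyx.symm]
          · simp [hix, hjx, hjy, hw, e1 j hjx, e2 j hjy]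
      · by_cases hiy : i = y
        · by_cases hjx : j = x
          · simp [hiy, hjx, hw, hx, hy, hyx, hyx.symm]
          · by_cases hjy : j = y
            · simp [hiy, hjy, hw, hx, hy, hyx, hyx.symm, h3]
            · simp [hiy, hjx, hjy, hw, hyx, e1 j hjx, e2 j hjy]
        · by_cases hjx : j = x
          · simp [hix, hiy, hjx, hw]
          · by_cases hjy : j = y
            · simp [hix, hiy, hjy, hw, hyx]
            · simp [hix, hiy, hjx, hjy, hw]

theorem exists_orthonormal_of_hasGramDet_one {n : ℕ} (Q : QuadraticForm (ZMod 3) V)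
    (hQ : HasGramDet Q n 1) :
    ∃ e : Fin n → V, ∀ i j, QuadraticMap.polarBilin Q (e i) (e j) = if i = j then 1 else 0 := by
  obtain ⟨b, hb⟩ := hQ
  have : Module.Finite (ZMod 3) V := Module.Finite.of_basis b
  have hinv : Invertible (2 : ZMod 3) := invertibleOfNonzero (by decide)
  have hsymm : (QuadraticMap.polarBilin Q).IsSymm := ⟨fun x y => QuadraticMap.polar_comm Q x y⟩
  have hfr : Module.finrank (ZMod 3) V = n := by simp [Module.finrank_eq_card_basis b]
  obtain ⟨v, hv⟩ := LinearMap.BilinForm.exists_orthogonal_basis hsymm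
  subst hfr
  set d := fun i => QuadraticMap.polarBilin Q (v i) (v i) with hd
  have hgram : ∀ i j, QuadraticMap.polarBilin Q (v i) (v j) = if i = j then d i else 0 := by
    intro i j
    split_ifs with hij
    · rw [← hij]
    · exact hv hij
  have hunit : IsUnit (b.det v) := b.isUnit_det v
  have hdet := gram_det_eq_sq_mul Q b v
  have hdiag : (Matrix.of fun i j => QuadraticMap.polar Q (v i) (v j)) = Matrix.diagonal d := by
    ext i j
    rw [Matrix.of_apply, Matrix.diagonal_apply]
    exact hgram i j
  rw [hb, mul_one, hdiag, Matrix.det_diagonal] at hdet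
  have hsq : ∀ x : ZMod 3, x ≠ 0 → x ^ 2 = 1 := by decide
  rw [hsq _ hunit.ne_zero] at hdet
  have hcases : ∀ x : ZMod 3, x ≠ 0 → x = if x = -1 then -1 else 1 := by decide
  have hd' : ∀ i, d i = if i ∈ Finset.univ.filter (fun i => d i = -1) then -1 else 1 := by
    intro i
    have hi : d i ≠ 0 := fun h0 => by
      rw [Finset.prod_eq_zero (Finset.mem_univ i) h0] at hdet
      exact zero_ne_one hdet
    simpa using hcases _ hi
  -- The discriminant `1` forces the number of vectors of norm `-1` to be even.
  have heven : Even (Finset.univ.filter (fun i => d i = -1)).card := by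
    rw [Finset.prod_congr rfl fun i _ => hd' i, Finset.prod_ite] at hdet
    simp only [Finset.mem_filter, Finset.mem_univ, true_and, Finset.prod_const,
      one_pow, mul_one] at hdet
    by_contra hodd
    rw [(Nat.not_even_iff_odd.1 hodd).neg_one_pow] at hdet
    exact absurd hdet (by decide)
  refine exists_orthonormal_of_even _ _ heven v fun i j => ?_
  rw [hgram, ← hd']

/-- The largest degree in question is attained. For `n ≡ 1` modulo `3` an orthonormal basis is a
simplex configuration of `n` points; otherwise the vectors `e i + c • ∑ k, e k` with `c = n - 1`,
the solution of `2 c + n c² = 1`, together with `0` form one of `n + 1` points. -/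
theorem mem_symmetricDegrees_of_hasGramDet_one {n : ℕ} (hn : 3 ≤ n)
    (Q : QuadraticForm (ZMod 3) V) (hQ : HasGramDet Q n 1) :
    (if n ≡ 1 [MOD 3] then n else n + 1) ∈ symmetricDegrees (projReflectionClass Q 1) := by
  obtain ⟨e, he⟩ := exists_orthonormal_of_hasGramDet_one Q hQ
  have h2 : (2 : ZMod 3) ≠ 0 := by decide
  split_ifs with hmod
  · have h : IsSimplexConfiguration Q e (fun _ => 0) := fun i j => by
      rw [he, add_zero, add_zero]
    refine h.mem_symmetricDegrees h2 ?_
    have : n ≠ 3 := by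
      rintro rfl
      exact absurd hmod (by decide)
    omega
  · have hn1 : (n : ZMod 3) ≠ 1 := fun h =>
      hmod ((ZMod.natCast_eq_natCast_iff n 1 3).1 (by simpa using h))
    obtain ⟨c, hc⟩ : ∃ c : ZMod 3, 2 * c + n * c ^ 2 = 1 := by
      have : ∀ x : ZMod 3, x ≠ 1 → ∃ c : ZMod 3, 2 * c + x * c ^ 2 = 1 := by decide
      exact this _ hn1
    have hs : ∀ i, QuadraticMap.polarBilin Q (e i) (∑ k, e k) = 1 := fun i => by
      rw [map_sum]
      simp only [he, Finset.sum_ite_eq, Finset.mem_univ, if_true]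
    have hs' : ∀ i, QuadraticMap.polarBilin Q (∑ k, e k) (e i) = 1 := fun i => by
      rw [map_sum, LinearMap.sum_apply]
      simp only [he, Finset.sum_ite_eq', Finset.mem_univ, if_true]
    have hss : QuadraticMap.polarBilin Q (∑ k, e k) (∑ k, e k) = n := by
      rw [map_sum]
      simp only [hs', Finset.sum_const, Finset.card_univ, Fintype.card_fin, nsmul_eq_mul, mul_one]
    have h : IsSimplexConfiguration Q (Fin.cons 0 fun i => e i + c • ∑ k, e k : Fin (n + 1) → V)
        (Fin.cons 1 fun _ => -1) := by
      intro i j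
      refine Fin.cases ?_ (fun i => ?_) i <;> refine Fin.cases ?_ (fun j => ?_) j
      · simp only [Fin.cons_zero, map_zero, if_true]
        decide
      · simp only [Fin.cons_zero, Fin.cons_succ, map_zero, LinearMap.zero_apply,
          (Fin.succ_ne_zero j).symm, if_false]
        decide
      · simp only [Fin.cons_zero, Fin.cons_succ, map_zero, Fin.succ_ne_zero i, if_false]
        decide
      · simp only [Fin.cons_succ, map_add, map_smul, LinearMap.add_apply, LinearMap.smul_apply,
          smul_eq_mul, he, hs, hs', hss, Fin.succ_inj]
        have h5 : ∀ x : ZMod 3, x + c * 1 + (c * 1 + c * (c * n)) = x + -1 + -1 := by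
          intro x
          have h6 : (1 : ZMod 3) = -1 + -1 := by decide
          linear_combination hc + h6
        split_ifs <;> linear_combination h5 _
    exact h.mem_symmetricDegrees h2 (by omega)

end Orthonormal

/-! ### Products of two reflections in the projective group -/

section Commuting

variable {K V : Type*} [Field K] [AddCommGroup V] [Module K V]

theorem exists_ne_zero_polar_eq_zero {n : ℕ} (hn : 3 ≤ n) (b : Module.Basis (Fin n) K V)
    (Q : QuadraticForm K V) (v w : V) :
    ∃ x : V, x ≠ 0 ∧ QuadraticMap.polar Q v x = 0 ∧ QuadraticMap.polar Q w x = 0 := by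
  have : Module.Finite K V := Module.Finite.of_basis b
  have hker : LinearMap.ker ((QuadraticMap.polarBilin Q v).prod (QuadraticMap.polarBilin Q w))
      ≠ ⊥ := LinearMap.ker_ne_bot_of_finrank_lt (by
    rw [Module.finrank_prod, Module.finrank_self, Module.finrank_eq_card_basis b, Fintype.card_fin]
    omega)
  obtain ⟨x, hx, hx0⟩ := Submodule.exists_mem_ne_zero_of_ne_bot hker
  have hx' := Prod.mk_eq_zero.1 (LinearMap.mem_ker.1 hx)
  exact ⟨x, hx0, hx'.1, hx'.2⟩

theorem mk_eq_mk_iff_exists_smul {Q : QuadraticForm K V} {π : K}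
    (g h : reflectionSubgroup Q π) :
    (QuotientGroup.mk g : ProjReflectionGroup Q π) = QuotientGroup.mk h ↔
      ∃ c : Kˣ, ∀ x, (h : V ≃ₗ[K] V) x = (c : K) • (g : V ≃ₗ[K] V) x := by
  rw [QuotientGroup.eq, Subgroup.mem_subgroupOf]
  constructor
  · rintro ⟨c, hc⟩
    refine ⟨c, fun x => ?_⟩
    have h1 : (h : V ≃ₗ[K] V) = g * DistribMulAction.toModuleAut K V c := by
      rw [hc]
      simp
    rw [h1, LinearEquiv.mul_apply]
    exact map_smul (g : V ≃ₗ[K] V) (c : K) x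
  · rintro ⟨c, hc⟩
    refine ⟨c, ?_⟩
    rw [Subgroup.coe_mul, Subgroup.coe_inv, eq_inv_mul_iff_mul_eq]
    refine LinearEquiv.ext fun x => ?_
    rw [hc, LinearEquiv.mul_apply]
    exact map_smul (g : V ≃ₗ[K] V) (c : K) x

theorem map_ne_zero_of_eq_one {Q : QuadraticForm K V} {v : V} (hv : Q v = 1) : Q v ≠ 0 :=
  ne_of_eq_of_ne hv one_ne_zero

/-- The image in the projective group of the reflection in a vector `v` with `Q v = 1`. -/
noncomputable def projReflection (Q : QuadraticForm K V) (v : V) (hv : Q v = 1) :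
    ProjReflectionGroup Q (1 : K) :=
  QuotientGroup.mk ⟨quadReflection Q v (map_ne_zero_of_eq_one hv),
    Subgroup.subset_closure ⟨v, map_ne_zero_of_eq_one hv, hv, rfl⟩⟩

theorem exists_eq_projReflection {Q : QuadraticForm K V} {x : ProjReflectionGroup Q (1 : K)}
    (hx : x ∈ projReflectionClass Q 1) :
    ∃ (v : V) (hv : Q v = 1), x = projReflection Q v hv := by
  obtain ⟨⟨g, hg'⟩, ⟨v, hv, hv1, hg⟩, rfl⟩ := hx
  subst hg
  exact ⟨v, hv1, rfl⟩

theorem quadReflection_apply_of_eq_one {Q : QuadraticForm K V} {v : V} (hv : Q v = 1) (x : V) :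
    quadReflection Q v (map_ne_zero_of_eq_one hv) x = x - QuadraticMap.polar Q v x • v := by
  rw [quadReflection_apply, hv, inv_one, one_mul]

theorem polar_self_of_eq_one {Q : QuadraticForm K V} {v : V} (hv : Q v = 1) :
    QuadraticMap.polar Q v v = 2 := by
  rw [QuadraticMap.polar_self, hv, nsmul_eq_mul, mul_one, Nat.cast_ofNat]

theorem map_sub_polar_smul {Q : QuadraticForm K V} {v : V} (hv : Q v = 1) (w : V) :
    Q (w - QuadraticMap.polar Q v w • v) = Q w := by
  rw [← quadReflection_apply_of_eq_one hv]
  exact reflectionSubgroup_le_isometrySubgroup Q 1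
    (Subgroup.subset_closure ⟨v, map_ne_zero_of_eq_one hv, hv, rfl⟩) w

theorem projReflection_congr {Q : QuadraticForm K V} {v w : V} (hv : Q v = 1) (hw : Q w = 1)
    {c : K} (hc : c * c = 1) (h : w = c • v) : projReflection Q v hv = projReflection Q w hw := by
  refine (mk_eq_mk_iff_exists_smul _ _).2 ⟨1, fun x => ?_⟩
  rw [Units.val_one, one_smul]
  change quadReflection Q w (map_ne_zero_of_eq_one hw) x =
    quadReflection Q v (map_ne_zero_of_eq_one hv) x
  rw [quadReflection_apply_of_eq_one hw, quadReflection_apply_of_eq_one hv, h,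
    QuadraticMap.polar_smul_left, smul_smul, smul_eq_mul]
  congr 2
  linear_combination QuadraticMap.polar Q v x * hc

/-- Conjugating a reflection by the reflection in `v` gives the reflection in the reflected
vector. -/
theorem projReflection_conj {Q : QuadraticForm K V} {v w : V} (hv : Q v = 1) (hw : Q w = 1)
    (hvw : Q (w - QuadraticMap.polar Q v w • v) = 1) :
    projReflection Q v hv * projReflection Q w hw * projReflection Q v hv =
      projReflection Q (w - QuadraticMap.polar Q v w • v) hvw := by
  refine (mk_eq_mk_iff_exists_smul _ _).2 ⟨1, fun x => ?_⟩
  rw [Units.val_one, one_smul]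
  change quadReflection Q _ (map_ne_zero_of_eq_one hvw) x =
    quadReflection Q v (map_ne_zero_of_eq_one hv) (quadReflection Q w (map_ne_zero_of_eq_one hw)
      (quadReflection Q v (map_ne_zero_of_eq_one hv) x))
  simp only [quadReflection_apply_of_eq_one hv, quadReflection_apply_of_eq_one hw,
    quadReflection_apply_of_eq_one hvw, QuadraticMap.polar_sub_left, QuadraticMap.polar_sub_right,
    QuadraticMap.polar_smul_left, QuadraticMap.polar_smul_right, polar_self_of_eq_one hv,
    QuadraticMap.polar_comm Q w v, smul_eq_mul]
  module

theorem projReflection_mul_comm_of_polar_eq_zero {Q : QuadraticForm K V} {v w : V}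
    (hv : Q v = 1) (hw : Q w = 1) (h : QuadraticMap.polar Q v w = 0) :
    projReflection Q v hv * projReflection Q w hw =
      projReflection Q w hw * projReflection Q v hv := by
  refine (mk_eq_mk_iff_exists_smul _ _).2 ⟨1, fun x => ?_⟩
  rw [Units.val_one, one_smul]
  change quadReflection Q w (map_ne_zero_of_eq_one hw)
      (quadReflection Q v (map_ne_zero_of_eq_one hv) x) =
    quadReflection Q v (map_ne_zero_of_eq_one hv) (quadReflection Q w (map_ne_zero_of_eq_one hw) x)
  simp only [quadReflection_apply_of_eq_one hv, quadReflection_apply_of_eq_one hw,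
    QuadraticMap.polar_sub_right, QuadraticMap.polar_smul_right,
    QuadraticMap.polar_comm Q w v, h, smul_eq_mul]
  module

end Commuting

section CharacteristicThree

variable {V : Type*} [AddCommGroup V] [Module (ZMod 3) V]

/-- In dimension at least three, commuting but distinct projective reflections come from
orthogonal vectors: the two products of the reflections agree up to a scalar, and the scalar is `1`
because both products fix a nonzero vector orthogonal to `v` and `w`. -/
theorem polar_eq_zero_of_commute {n : ℕ} (hn : 3 ≤ n) (b : Module.Basis (Fin n) (ZMod 3) V)
    {Q : QuadraticForm (ZMod 3) V} {v w : V} (hv : Q v = 1) (hw : Q w = 1)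
    (hcomm : projReflection Q v hv * projReflection Q w hw =
      projReflection Q w hw * projReflection Q v hv)
    (hne : projReflection Q v hv ≠ projReflection Q w hw) : QuadraticMap.polar Q v w = 0 := by
  obtain ⟨c, hc⟩ := (mk_eq_mk_iff_exists_smul _ _).1 hcomm
  replace hc : ∀ x, quadReflection Q w (map_ne_zero_of_eq_one hw)
      (quadReflection Q v (map_ne_zero_of_eq_one hv) x) =
      (c : ZMod 3) • quadReflection Q v (map_ne_zero_of_eq_one hv)
        (quadReflection Q w (map_ne_zero_of_eq_one hw) x) := hc
  simp only [quadReflection_apply_of_eq_one hv, quadReflection_apply_of_eq_one hw] at hc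
  obtain ⟨x, hx0, hxv, hxw⟩ := exists_ne_zero_polar_eq_zero hn b Q v w
  have hc1 : (c : ZMod 3) = 1 := by
    have h := hc x
    simp only [hxv, hxw, zero_smul, sub_zero] at h
    by_contra hne1
    have h' : (1 - (c : ZMod 3)) • x = 0 := by
      rw [sub_smul, one_smul, ← h, sub_self]
    exact (smul_eq_zero.1 h').elim (fun h1 => hne1 (sub_eq_zero.1 h1).symm) hx0
  by_contra hp
  have h := hc w
  simp only [hc1, QuadraticMap.polar_sub_right, QuadraticMap.polar_smul_right,
    polar_self_of_eq_one hw, QuadraticMap.polar_comm Q w v, smul_eq_mul, one_smul] at h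
  have h3 : (3 : ZMod 3) = 0 := by decide
  set p := QuadraticMap.polar Q v w
  have hsq : p * p = 1 := (by decide : ∀ x : ZMod 3, x ≠ 0 → x * x = 1) p hp
  refine hne (projReflection_congr hv hw (c := -p) (by linear_combination hsq) ?_)
  linear_combination (norm := module) h - hsq • w + (h3 * p) • v

end CharacteristicThree

/-! ### The bound on the degree -/

theorem symmetricDegrees_image {G H : Type*} [Group G] [Group H] (e : G ≃* H) (D : Set G) :
    symmetricDegrees (e '' D) = symmetricDegrees D := by
  ext m
  constructor
  · rintro ⟨f, hf, hD⟩
    refine ⟨e.symm.toMonoidHom.comp f, e.symm.injective.comp hf, fun i j hij => ?_⟩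
    obtain ⟨x, hx, hxf⟩ := hD i j hij
    simpa [← hxf] using hx
  · rintro ⟨f, hf, hD⟩
    exact ⟨e.toMonoidHom.comp f, e.injective.comp hf, fun i j hij => ⟨_, hD i j hij, rfl⟩⟩

theorem mem_symmetricDegrees_of_le {G : Type*} [Group G] {D : Set G} {k m : ℕ} (hkm : k ≤ m)
    (hm : m ∈ symmetricDegrees D) : k ∈ symmetricDegrees D := by
  obtain ⟨f, hf, hD⟩ := hm
  refine ⟨f.comp (Equiv.Perm.viaEmbeddingHom (Fin.castLEEmb hkm)),
    hf.comp (Equiv.Perm.viaEmbeddingHom_injective _), fun i j hij => ?_⟩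
  have h : Equiv.Perm.viaEmbeddingHom (Fin.castLEEmb hkm) (Equiv.swap i j) =
      Equiv.swap (Fin.castLE hkm i) (Fin.castLE hkm j) := by
    rw [Equiv.Perm.viaEmbeddingHom_apply]
    ext x
    by_cases hx : x ∈ Set.range (Fin.castLEEmb hkm)
    · obtain ⟨y, rfl⟩ := hx
      rw [Equiv.Perm.viaEmbedding_apply]
      exact congrArg Fin.val ((Fin.castLE_injective hkm).swap_apply i j y).symm
    · rw [Equiv.Perm.viaEmbedding_apply_of_notMem _ _ _ hx, Equiv.swap_apply_of_ne_of_ne]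
      · exact fun h => hx ⟨i, h.symm⟩
      · exact fun h => hx ⟨j, h.symm⟩
  rw [MonoidHom.comp_apply, h]
  exact hD _ _ fun h' => hij (Fin.castLE_injective hkm h')

section Bound

variable {V : Type*} [AddCommGroup V] [Module (ZMod 3) V]

/-- The transpositions `(0 i)` of `S_{k+1}` are reflections in vectors which, after changing signs,
have Gram matrix identity plus all-ones. Two such vectors are not orthogonal because `(0 i)` and
`(0 j)` do not commute, and the product of the inner products around a triangle is `1` because
`(i j)`, the reflection in the reflected vector, commutes with `(0 l)`. -/
theorem exists_star_family {n k : ℕ} (hn : 3 ≤ n) (b : Module.Basis (Fin n) (ZMod 3) V)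
    (Q : QuadraticForm (ZMod 3) V)
    (hk : k + 1 ∈ symmetricDegrees (projReflectionClass Q (1 : ZMod 3))) :
    ∃ w : Fin k → V, ∀ i j, QuadraticMap.polar Q (w i) (w j) = if i = j then 2 else 1 := by
  obtain ⟨f, hf, hD⟩ := hk
  have h0 : ∀ i : Fin k, (0 : Fin (k + 1)) ≠ i.succ := fun i => (Fin.succ_ne_zero i).symm
  choose v hv hfv using fun i : Fin k => exists_eq_projReflection (hD 0 i.succ (h0 i))
  have hp : ∀ i j, i ≠ j → QuadraticMap.polar Q (v i) (v j) ≠ 0 := by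
    intro i j hij hp
    have h1 := projReflection_mul_comm_of_polar_eq_zero (hv i) (hv j) hp
    rw [← hfv, ← hfv, ← map_mul, ← map_mul] at h1
    have h2 := congrArg (fun σ : Equiv.Perm (Fin (k + 1)) => σ i.succ) (hf h1)
    have h3 : i.succ ≠ j.succ := fun h => hij (Fin.succ_injective _ h)
    simp only [Equiv.Perm.mul_apply, Equiv.swap_apply_right, Equiv.swap_apply_left,
      Equiv.swap_apply_of_ne_of_ne (h0 i).symm h3] at h2
    exact h0 j h2
  have htri : ∀ i j l, i ≠ j → i ≠ l → j ≠ l →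
      QuadraticMap.polar Q (v j) (v l) =
        QuadraticMap.polar Q (v i) (v j) * QuadraticMap.polar Q (v i) (v l) := by
    intro i j l hij hil hjl
    have hs : ∀ {x y : Fin k}, x ≠ y → x.succ ≠ y.succ := fun h h' => h (Fin.succ_injective _ h')
    have hu : Q (v j - QuadraticMap.polar Q (v i) (v j) • v i) = 1 := by
      rw [map_sub_polar_smul (hv i), hv j]
    have hfu : f (Equiv.swap i.succ j.succ) = projReflection Q _ hu := by
      rw [← projReflection_conj (hv i) (hv j), ← hfv, ← hfv, ← map_mul, ← map_mul]
      congr 1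
      rw [Equiv.swap_comm 0 j.succ]
      exact (Equiv.swap_mul_swap_mul_swap (h0 j).symm (hs hij.symm)).symm
    have hzero := polar_eq_zero_of_commute hn b hu (hv l) (by
        rw [← hfu, ← hfv, ← map_mul, ← map_mul]
        congr 1
        exact (Equiv.Perm.disjoint_swap_swap (by
          simp [hs hij, hs hil, hs hjl, h0 l])).commute) (by
        rw [← hfu, ← hfv]
        intro h
        have h2 := congrArg (fun σ : Equiv.Perm (Fin (k + 1)) => σ 0) (hf h)
        simp only [Equiv.swap_apply_left, Equiv.swap_apply_of_ne_of_ne (h0 i) (h0 j)] at h2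
        exact h0 l h2)
    rw [QuadraticMap.polar_sub_left, QuadraticMap.polar_smul_left, smul_eq_mul] at hzero
    linear_combination hzero
  have hsq : ∀ x : ZMod 3, x ≠ 0 → x * x = 1 := by decide
  obtain rfl | hpos := Nat.eq_zero_or_pos k
  · exact ⟨fun i => i.elim0, fun i => i.elim0⟩
  let o : Fin k := ⟨0, hpos⟩
  -- Changing the signs to `s` makes all inner products with the vector of index `o` equal to `1`,
  -- hence all others too, by the triangle relation `htri`.
  let s : Fin k → ZMod 3 := fun i => if i = o then 1 else QuadraticMap.polar Q (v o) (v i)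
  have hs : ∀ i, s i * s i = 1 := by
    intro i
    by_cases hi : i = o
    · simp [s, hi]
    · simpa [s, hi] using hsq _ (hp o i (Ne.symm hi))
  have hvs : ∀ i j, i ≠ j → QuadraticMap.polar Q (v i) (v j) = s i * s j := by
    intro i j hij
    by_cases hi : i = o
    · have hj : j ≠ o := fun h => hij (hi.trans h.symm)
      simp [s, hi, hj]
    · by_cases hj : j = o
      · simp [s, hi, hj, QuadraticMap.polar_comm Q (v i)]
      · simpa [s, hi, hj] using htri o i j (Ne.symm hi) (Ne.symm hj) hij
  refine ⟨fun i => s i • v i, fun i j => ?_⟩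
  rw [QuadraticMap.polar_smul_left, QuadraticMap.polar_smul_right, smul_eq_mul, smul_eq_mul]
  split_ifs with hij
  · rw [← hij, polar_self_of_eq_one (hv i)]
    linear_combination 2 * hs i
  · rw [hvs i j hij]
    linear_combination s j * s j * hs i + hs j

theorem le_of_mem_symmetricDegrees {n m : ℕ} (hn : 3 ≤ n) (Q : QuadraticForm (ZMod 3) V)
    (hQ : HasGramDet Q n 1) (hm : m ∈ symmetricDegrees (projReflectionClass Q (1 : ZMod 3))) :
    m ≤ if n ≡ 1 [MOD 3] then n else n + 1 := by
  obtain ⟨b, hb⟩ := hQ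
  have hdet : ∀ k, k + 1 ≤ m → ∃ w : Fin k → V,
      (Matrix.of fun i j => QuadraticMap.polar Q (w i) (w j)).det = k + 1 := by
    intro k hk
    obtain ⟨w, hw⟩ := exists_star_family hn b Q (mem_symmetricDegrees_of_le hk hm)
    refine ⟨w, ?_⟩
    simp only [hw]
    exact det_one_add_all_ones k
  split_ifs with hmod
  · -- Otherwise a family of `n` vectors has Gram determinant `n + 1 = 2`, which is not a square.
    by_contra! hlt
    obtain ⟨w, hw⟩ := hdet n hlt
    rw [gram_det_eq_sq_mul Q b w, hb, mul_one,
      (ZMod.natCast_eq_natCast_iff n 1 3).2 hmod, Nat.cast_one] at hw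
    exact (by decide : ∀ x : ZMod 3, x ^ 2 ≠ 1 + 1) _ hw
  · -- Otherwise `n + 1` vectors have Gram determinant `n + 2 ≠ 0`.
    by_contra! hlt
    obtain ⟨w, hw⟩ := hdet (n + 1) hlt
    have hne : ((n + 1 : ℕ) + 1 : ZMod 3) ≠ 0 := by
      intro h
      refine hmod ((ZMod.natCast_eq_natCast_iff n 1 3).1 ?_)
      have h3 : (3 : ZMod 3) = 0 := by decide
      push_cast at h ⊢
      linear_combination h - h3
    have := le_of_gram_det_ne_zero Q b w (by rw [hw]; exact hne)
    omega

end Bound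

/-- The case of discriminant `1` and reflections `t(v)` with `Q v = 1` over the field with three
elements. -/
theorem mainTheorem5 (n : ℕ) (hn : 3 ≤ n)
    {V : Type*} [AddCommGroup V] [Module (ZMod 3) V]
    (Q : QuadraticForm (ZMod 3) V) (hQ : HasGramDet Q n 1)
    {G : Type*} [Group G] (D : Set G)
    (e : G ≃* ProjReflectionGroup Q 1) (hD : e '' D = projReflectionClass Q 1) :
    IsGreatest (symmetricDegrees D) (if n ≡ 1 [MOD 3] then n else n + 1) := by
  rw [← symmetricDegrees_image e D, hD]
  exact ⟨mem_symmetricDegrees_of_hasGramDet_one hn Q hQ,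
    fun _ hm => le_of_mem_symmetricDegrees hn Q hQ hm⟩
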